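/- Let $\mathcal C$ be a monoidal category and $A$ an object of $\mathcal C$ (associativity and unit constraints are suppressed; $\mathcal C$ need not be strict). A \emph{quasi-commutative monoid structure} on $A$ is a monoid structure $(\mu,\iota)$ on $A$ together with an isomorphism $R:A\otimes A\to A\otimes A$ such that $$(R\otimes I)(I\otimes R)(R\otimes I)=(I\otimes R)(R\otimes I)(I\otimes R),$$ $$R(\iota\otimes I)=I\otimes\iota,\quad R(I\otimes\iota)=\iota\otimes I,$$ $$R(I\otimes\mu)=(\mu\otimes I)(I\otimes R)(R\otimes I),\quad R(\mu\otimes I)=(I\otimes\mu)(R\otimes I)(I\otimes R),$$ $$\mu R=\mu .$$ Let $\Delta$ be the category of the finite ordinals $[n]=\{1,\dots,n\}$, $n\ge 0$, and order-preserving maps, and let $\Delta_{\le 3}$ be its full subcategory on $[0],[1],[2],[3]$. A \emph{cosimplicial monoid} (respectively a \emph{cosimplicial monoid truncated at length $3$}) in $\mathcal C$ is a functor $A^*$, $[n]\mapsto A^n$, from $\Delta$ (respectively $\Delta_{\le 3}$) to the category of monoids in $\mathcal C$. It satisfies the \emph{covering condition} if for every finite family (the empty family included) of injective order-preserving maps $f_i:[n_i]\to[n]$,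 $i=1,\dots,m$, in the indexing category, with pairwise disjoint images whose union is $[n]$, the covering map $$\bigotimes_{i=1}^m A^{n_i}\xrightarrow{\ \bigotimes_i A^{f_i}\ }(A^n)^{\otimes m}\xrightarrow{\ \text{mult}\ }A^n$$ is an isomorphism, where mult is the iterated multiplication (the unit map $1\to A^n$ if $m=0$). Consider (i) the set of quasi-commutative monoid structures on $A$, viewed as a discrete category; (ii) the category of cosimplicial monoids $A^*$ which satisfy the covering condition and have $A^1=A$ as an object of $\mathcal C$, whose morphisms are the morphisms of cosimplicial monoids that are the identity on $A^1=A$; (iii) the category defined in the same way with cosimplicial monoids truncated at length $3$. Then the three are equivalent. More precisely, truncation is an equivalence of categories from (ii) to (iii), and there is an equivalence of categories from (iii) to (i), hence by composition also one from (ii) to (i), which sends $A^*$ to the monoid structure of $A^1=A$ together with the operator $$R=(\mu(\partial_0\otimes\partial_1))^{-1}\,\mu(\partial_1\otimes\partial_0).$$ Here $\mu$ is the multiplication of $A^2$, the maps $\partial_0,\partial_1:A^1\to A^2$ are induced by the injections $[1]\to[2]$ with images $\{2\}$ and $\{1\}$ respectively, and $\mu(\partial_0\otimes\partial_1)$ is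 an isomorphism. -/

import Mathlib

open CategoryTheory MonoidalCategory

universe v u

namespace QuasiComm

/-! ### Quasi-commutative monoids

The monoidal category `C` is not assumed to be strict, so the associators and unitors, which are
identities in the strict case, are written out. Composition `f ≫ g` is "first `f`, then `g`". -/

section Structures

variable {C : Type u} [Category.{v} C] [MonoidalCategory C]

/-- `R ⊗ I` on the triple tensor power `A ⊗ (A ⊗ A)`. -/
def onFirstTwo {A : C} (R : A ⊗ A ⟶ A ⊗ A) : A ⊗ (A ⊗ A) ⟶ A ⊗ (A ⊗ A) :=
  (α_ A A A).inv ≫ R ▷ A ≫ (α_ A A A).hom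

/-- `I ⊗ R` on the triple tensor power `A ⊗ (A ⊗ A)`. -/
def onLastTwo {A : C} (R : A ⊗ A ⟶ A ⊗ A) : A ⊗ (A ⊗ A) ⟶ A ⊗ (A ⊗ A) :=
  A ◁ R

/-- The structure of a quasi-commutative monoid on an object `A`: a monoid structure together with
a Yang-Baxter operator `R` (an invertible solution of the Yang-Baxter equation) which is compatible
with the unit and with the multiplication, and such that `μ R = μ`. -/
structure QuasiCommutativeStructure (A : C) extends MonObj A where
  R : A ⊗ A ≅ A ⊗ A
  /-- `(R ⊗ I)(I ⊗ R)(R ⊗ I) = (I ⊗ R)(R ⊗ I)(I ⊗ R)` -/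
  yang_baxter :
    onFirstTwo R.hom ≫ onLastTwo R.hom ≫ onFirstTwo R.hom =
      onLastTwo R.hom ≫ onFirstTwo R.hom ≫ onLastTwo R.hom
  /-- `R(ι ⊗ I) = I ⊗ ι` -/
  one_left : (λ_ A).inv ≫ one ▷ A ≫ R.hom = (ρ_ A).inv ≫ A ◁ one
  /-- `R(I ⊗ ι) = ι ⊗ I` -/
  one_right : (ρ_ A).inv ≫ A ◁ one ≫ R.hom = (λ_ A).inv ≫ one ▷ A
  /-- `R(I ⊗ μ) = (μ ⊗ I)(I ⊗ R)(R ⊗ I)` -/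
  mul_right : A ◁ mul ≫ R.hom =
    onFirstTwo R.hom ≫ onLastTwo R.hom ≫ (α_ A A A).inv ≫ mul ▷ A
  /-- `R(μ ⊗ I) = (I ⊗ μ)(R ⊗ I)(I ⊗ R)` -/
  mul_left : (α_ A A A).inv ≫ mul ▷ A ≫ R.hom =
    onLastTwo R.hom ≫ onFirstTwo R.hom ≫ A ◁ mul
  /-- `μ R = μ` -/
  comm : R.hom ≫ mul = mul

end Structures

/-! ### Finite ordinals and their truncations -/

/-- The objects `[n]` with `n ≤ N`, where `[n]` is the ordered set with `n` elements. -/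
@[ext]
structure FinOrdinal (N : ℕ∞) where
  card : ℕ
  card_le : (card : ℕ∞) ≤ N

/-- The category of the finite ordinals `[0], [1], [2], …` with at most `N` elements and
order-preserving maps. For `N = ⊤` it is the category of all finite ordinals (the empty one
included), for `N = 3` it is its full subcategory on `[0], [1], [2], [3]`. -/
instance (N : ℕ∞) : Category (FinOrdinal N) where
  Hom m n := Fin m.card →o Fin n.card
  id _ := OrderHom.id
  comp f g := g.comp f

/-- The full inclusion of the ordinals with at most `M` elements into those with at most `N`. -/
def FinOrdinal.inclusion {M N : ℕ∞} (h : M ≤ N) : FinOrdinal M ⥤ FinOrdinal N where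
  obj n := ⟨n.card, n.card_le.trans h⟩
  map f := f

/-- The object `[1]`. -/
def FinOrdinal.one {N : ℕ∞} (h : 3 ≤ N) : FinOrdinal N := ⟨1, le_trans (by norm_num) h⟩

/-- The object `[2]`. -/
def FinOrdinal.two {N : ℕ∞} (h : 3 ≤ N) : FinOrdinal N := ⟨2, le_trans (by norm_num) h⟩

/-- The injection `∂_j : [1] → [2]`, for `j = 0, 1`, which misses the `j`-th element (counted from
`0`): `∂_0` hits the last element of `[2]`, and `∂_1` hits the first one. -/
def FinOrdinal.coface {N : ℕ∞} (h : 3 ≤ N) (j : Fin 2) : FinOrdinal.one h ⟶ FinOrdinal.two h :=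
  (Fin.succAboveOrderEmb j : Fin 1 ↪o Fin 2).toOrderHom

/-! ### Cosimplicial monoids and the covering condition -/

section Cosimplicial

variable {C : Type u} [Category.{v} C] [MonoidalCategory C]

/-- The tensor product `X 0 ⊗ (X 1 ⊗ (… ⊗ I))`, the unit object if there are no factors. -/
def tensorFamily : {m : ℕ} → (Fin m → C) → C
  | 0, _ => 𝟙_ C
  | _ + 1, X => X 0 ⊗ tensorFamily (fun i => X i.succ)

/-- The tensor product of a finite family of morphisms. -/
def tensorFamilyMap : {m : ℕ} → {X Y : Fin m → C} → (∀ i, X i ⟶ Y i) →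
    (tensorFamily X ⟶ tensorFamily Y)
  | 0, _, _, _ => 𝟙 (𝟙_ C)
  | _ + 1, _, _, f => f 0 ⊗ₘ tensorFamilyMap (fun i => f i.succ)

/-- The iterated multiplication `M ⊗ … ⊗ M ⟶ M`; it is the unit map if there are no factors. -/
def iteratedMul (M : Mon C) : (m : ℕ) → (tensorFamily (fun _ : Fin m => M.X) ⟶ M.X)
  | 0 => MonObj.one
  | m + 1 => M.X ◁ iteratedMul M m ≫ MonObj.mul

/-- The map `⊗ᵢ M^{nᵢ} ⟶ (Mⁿ)^{⊗ m} ⟶ Mⁿ` of a finite family of maps `fᵢ : [nᵢ] → [n]`. -/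
def coveringMap {N : ℕ∞} (M : FinOrdinal N ⥤ Mon C) {n : FinOrdinal N} {m : ℕ}
    {k : Fin m → FinOrdinal N} (f : ∀ i, k i ⟶ n) :
    tensorFamily (fun i => (M.obj (k i)).X) ⟶ (M.obj n).X :=
  tensorFamilyMap (fun i => (M.map (f i)).hom) ≫ iteratedMul (M.obj n) m

/-- The underlying order-preserving map of a morphism of ordinals. -/
def FinOrdinal.toFun {N : ℕ∞} {m n : FinOrdinal N} (f : m ⟶ n) : Fin m.card → Fin n.card :=
  (show Fin m.card →o Fin n.card from f)

/-- The covering condition: for every finite (possibly empty) family of injective order-preserving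
maps `fᵢ : [nᵢ] → [n]` with pairwise disjoint images whose union is `[n]`, the covering map is
invertible. -/
def CoveringCondition {N : ℕ∞} (M : FinOrdinal N ⥤ Mon C) : Prop :=
  ∀ (n : FinOrdinal N) (m : ℕ) (k : Fin m → FinOrdinal N) (f : ∀ i, k i ⟶ n),
    (∀ i, Function.Injective (FinOrdinal.toFun (f i))) →
    (∀ i j, i ≠ j →
      Disjoint (Set.range (FinOrdinal.toFun (f i))) (Set.range (FinOrdinal.toFun (f j)))) →
    (⋃ i, Set.range (FinOrdinal.toFun (f i))) = Set.univ →
    IsIso (coveringMap M f)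

/-- A cosimplicial monoid `A^*` in `C`, truncated at length `N` (not truncated if `N = ⊤`), which
satisfies the covering condition and has `A^1 = A`. -/
structure CosimplicialMonoidOn (N : ℕ∞) (h : 3 ≤ N) (A : C) where
  functor : FinOrdinal N ⥤ Mon C
  obj_one : (functor.obj (FinOrdinal.one h)).X = A
  covering : CoveringCondition functor

namespace CosimplicialMonoidOn

variable {N : ℕ∞} {h : 3 ≤ N} {A : C}

/-- The equality `A^1 = A` as an isomorphism. -/
def isoOne (X : CosimplicialMonoidOn N h A) : (X.functor.obj (FinOrdinal.one h)).X ≅ A :=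
  eqToIso X.obj_one

/-- A morphism is a morphism of cosimplicial monoids which is the identity on `A^1 = A`. -/
@[ext]
structure Hom (X Y : CosimplicialMonoidOn N h A) where
  app : X.functor ⟶ Y.functor
  app_one : (app.app (FinOrdinal.one h)).hom ≫ Y.isoOne.hom = X.isoOne.hom

instance : Category (CosimplicialMonoidOn N h A) where
  Hom X Y := Hom X Y
  id X := ⟨𝟙 X.functor, by simp⟩
  comp f g := ⟨f.app ≫ g.app, by simp [g.app_one, f.app_one]⟩
  id_comp f := Hom.ext (Category.id_comp f.app)
  comp_id f := Hom.ext (Category.comp_id f.app)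
  assoc f g k := Hom.ext (Category.assoc f.app g.app k.app)

/-- The monoid structure which `A` has as the monoid `A^1`. -/
@[reducible]
def monObj (X : CosimplicialMonoidOn N h A) : MonObj A :=
  MonObj.ofIso X.isoOne

/-- The map `∂_j : A = A^1 ⟶ A^2`. -/
def coface (X : CosimplicialMonoidOn N h A) (j : Fin 2) :
    A ⟶ (X.functor.obj (FinOrdinal.two h)).X :=
  X.isoOne.inv ≫ (X.functor.map (FinOrdinal.coface h j)).hom

/-- The map `μ(∂_i ⊗ ∂_j) : A ⊗ A ⟶ A^2`. -/
def mulCofaces (X : CosimplicialMonoidOn N h A) (i j : Fin 2) :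
    A ⊗ A ⟶ (X.functor.obj (FinOrdinal.two h)).X :=
  (X.coface i ⊗ₘ X.coface j) ≫ MonObj.mul

/-- Restriction of a cosimplicial monoid to its components of length at most `3`. -/
def truncate (A : C) :
    CosimplicialMonoidOn ⊤ le_top A ⥤ CosimplicialMonoidOn 3 le_rfl A where
  obj X :=
    { functor := FinOrdinal.inclusion le_top ⋙ X.functor
      obj_one := X.obj_one
      covering := fun n m k f hinj hdisj hcov =>
        X.covering ((FinOrdinal.inclusion le_top).obj n) m
          (fun i => (FinOrdinal.inclusion le_top).obj (k i)) f hinj hdisj hcov }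
  map f :=
    { app := Functor.whiskerLeft (FinOrdinal.inclusion le_top) f.app
      app_one := f.app_one }

end CosimplicialMonoidOn

end Cosimplicial

end QuasiComm

/-!
A quasi-commutative structure on `A` is a rule for sorting words. In a cosimplicial monoid `A^*` the
`n` maps `[1] ⟶ [n]` give generators `g 0, …, g (n - 1) : A ⟶ A^n`. They are multiplicative, and
`g i g j = (g j g i) R` for `i < j`: in `A^2` this is the definition of `R`, and it is transported
along `[2] ⟶ [n]`. Call such a tuple ordered (`IsOrdered`). The covering condition for singletons
says that the decreasing product `g (n - 1) ⋯ g 0` is an isomorphism from `A^{⊗ n}`.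

Sorting a product of two decreasing products is done by one morphism `powMul` of `A^{⊗ n} ⊗ A^{⊗ n}`
to `A^{⊗ n}`, which depends only on `μ` and `R` (`IsOrdered.descProd_mul_descProd`). Hence a monoid
with an ordered `n`-tuple whose decreasing product is invertible (a `Model`) is universal among the
monoids with an ordered `n`-tuple (`Model.lift`, `Model.hom_ext`). So a cosimplicial monoid with the
covering condition is determined by `μ` and `R`, up to a unique isomorphism which is the identity on
`A`. The axioms of a quasi-commutative structure follow by sorting words in `A^1`, `A^2` and `A^3`
in two ways, which is why components of length at most `3` suffice.

Conversely, given a quasi-commutative structure, a model of length `n` is `A^{⊗ n}` with the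
multiplication `powMul`. Associativity is not checked on diagrams: the generators act on `A^{⊗ n}`
itself from the left (`regularAction`), these actions form an ordered tuple, and the action on the
unit is faithful (`powOne_descProd_regularAction`), so that the monoid axioms are inherited from the
composition of actions. Models are functorial in `[n]` since ordered tuples can be reindexed along
monotone maps. The covering condition holds since `R` is invertible, so that any two orderings of a
product of generators differ by an isomorphism (`listProd_perm`).

To treat elements of a monoid and actions on an object alike, the sorting is done in an arbitrary
`ElementMonoid`, a lax monoidal presheaf.
-/

namespace QuasiComm

/-! ### Generalized elements -/

/-- A presheaf of "generalized elements" on `C` with an associative and unital multiplication, that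
is, a lax monoidal presheaf of types. The structure morphisms of `C` are absorbed in `pull`, so
that computations with elements need no coherence. -/
structure ElementMonoid (C : Type u) [Category.{v} C] [MonoidalCategory C] where
  El : C → Type v
  pull : ∀ {X Y : C}, (X ⟶ Y) → El Y → El X
  pull_id : ∀ {X : C} (x : El X), pull (𝟙 X) x = x
  pull_comp : ∀ {X Y Z : C} (f : X ⟶ Y) (g : Y ⟶ Z) (z : El Z), pull (f ≫ g) z = pull f (pull g z)
  one : El (𝟙_ C)
  mul : ∀ {X Y : C}, El X → El Y → El (X ⊗ Y)
  pull_tensor : ∀ {X Y X' Y' : C} (f : X ⟶ X') (g : Y ⟶ Y') (x : El X') (y : El Y'),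
    pull (f ⊗ₘ g) (mul x y) = mul (pull f x) (pull g y)
  one_mul : ∀ {X : C} (x : El X), mul one x = pull (λ_ X).hom x
  mul_one : ∀ {X : C} (x : El X), mul x one = pull (ρ_ X).hom x
  mul_assoc : ∀ {X Y Z : C} (x : El X) (y : El Y) (z : El Z),
    mul (mul x y) z = pull (α_ X Y Z).hom (mul x (mul y z))

variable {C : Type u} [Category.{v} C] [MonoidalCategory C]

namespace ElementMonoid

section Basic

variable (H : ElementMonoid C)

lemma pull_whiskerRight {X X' Y : C} (f : X ⟶ X') (x : H.El X') (y : H.El Y) :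
    H.pull (f ▷ Y) (H.mul x y) = H.mul (H.pull f x) y := by
  rw [← tensorHom_id, H.pull_tensor, H.pull_id]

lemma pull_whiskerLeft {X Y Y' : C} (f : Y ⟶ Y') (x : H.El X) (y : H.El Y') :
    H.pull (X ◁ f) (H.mul x y) = H.mul x (H.pull f y) := by
  rw [← id_tensorHom, H.pull_tensor, H.pull_id]

lemma pull_assoc_hom {X Y Z : C} (x : H.El X) (y : H.El Y) (z : H.El Z) :
    H.pull (α_ X Y Z).hom (H.mul x (H.mul y z)) = H.mul (H.mul x y) z :=
  (H.mul_assoc x y z).symm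

lemma pull_assoc_inv {X Y Z : C} (x : H.El X) (y : H.El Y) (z : H.El Z) :
    H.pull (α_ X Y Z).inv (H.mul (H.mul x y) z) = H.mul x (H.mul y z) := by
  rw [H.mul_assoc, ← H.pull_comp, Iso.inv_hom_id, H.pull_id]

lemma pull_leftUnitor_inv {X : C} (x : H.El X) :
    H.pull (λ_ X).inv (H.mul H.one x) = x := by
  rw [H.one_mul, ← H.pull_comp, Iso.inv_hom_id, H.pull_id]

lemma pull_rightUnitor_inv {X : C} (x : H.El X) :
    H.pull (ρ_ X).inv (H.mul x H.one) = x := by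
  rw [H.mul_one, ← H.pull_comp, Iso.inv_hom_id, H.pull_id]

end Basic

/-- The elements of a monoid: the presheaf represented by `M`, with the convolution product. -/
@[reducible]
def ofMon (M : Mon C) : ElementMonoid C where
  El X := X ⟶ M.X
  pull f x := f ≫ x
  pull_id := by simp
  pull_comp := by simp
  one := MonObj.one
  mul x y := (x ⊗ₘ y) ≫ MonObj.mul
  pull_tensor f g x y := by simp
  one_mul x := by
    rw [tensorHom_def', Category.assoc, MonObj.one_mul, leftUnitor_naturality]
  mul_one x := by
    rw [MonoidalCategory.tensorHom_def, Category.assoc, MonObj.mul_one, rightUnitor_naturality]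
  mul_assoc x y z := by
    rw [show ((x ⊗ₘ y) ≫ MonObj.mul) ⊗ₘ z = ((x ⊗ₘ y) ⊗ₘ z) ≫ MonObj.mul ▷ M.X by
        rw [← tensorHom_id, tensorHom_comp_tensorHom, Category.comp_id],
      show x ⊗ₘ ((y ⊗ₘ z) ≫ MonObj.mul) = (x ⊗ₘ (y ⊗ₘ z)) ≫ M.X ◁ MonObj.mul by
        rw [← id_tensorHom, tensorHom_comp_tensorHom, Category.comp_id],
      Category.assoc, MonObj.mul_assoc, Category.assoc, associator_naturality_assoc]

/-- The generalized endomorphisms `X ⊗ V ⟶ V` of an object `V`, multiplied by composition. They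
play the role of the elements of an internal endomorphism monoid, which need not exist in `C`. -/
@[reducible]
def ofObj (V : C) : ElementMonoid C where
  El X := X ⊗ V ⟶ V
  pull f x := f ▷ V ≫ x
  pull_id := by simp
  pull_comp := by simp
  one := (λ_ V).hom
  mul {X Y} x y := (α_ X Y V).hom ≫ X ◁ y ≫ x
  pull_tensor f g x y := by
    rw [MonoidalCategory.tensorHom_def', comp_whiskerRight, Category.assoc,
      associator_naturality_left_assoc, associator_naturality_middle_assoc,
      ← whisker_exchange_assoc, MonoidalCategory.whiskerLeft_comp, Category.assoc]
  one_mul x := by simp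
  mul_one x := by simp
  mul_assoc x y z := by simp

end ElementMonoid

open ElementMonoid

/-! ### Ordered tuples of elements -/

/-- The tensor power `A ⊗ (A ⊗ (⋯ ⊗ 𝟙))` with `n` factors `A`. It is reducible so that
`tensorPow A (n + 1)` and `A ⊗ tensorPow A n` are identified by rewriting. -/
@[reducible]
def tensorPow (A : C) : ℕ → C
  | 0 => 𝟙_ C
  | n + 1 => A ⊗ tensorPow A n

namespace ElementMonoid

/-- The product `g (n - 1) ⋯ g 1 g 0`, in decreasing order of the indices. For the
generators of a cosimplicial monoid this is, up to an isomorphism, the covering map of the family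
of all singletons, listed in decreasing order. -/
def descProd (H : ElementMonoid C) {A : C} : {n : ℕ} → (Fin n → H.El A) → H.El (tensorPow A n)
  | 0, _ => H.one
  | n + 1, g => H.mul (g (Fin.last n)) (descProd H (fun i => g i.castSucc))

end ElementMonoid

namespace QuasiCommutativeStructure

variable {A : C} (Q : QuasiCommutativeStructure A)

/-- The unit `ι`. -/
abbrev unit : 𝟙_ C ⟶ A := Q.toMonObj.one

/-- The multiplication `μ`. -/
abbrev mult : A ⊗ A ⟶ A := Q.toMonObj.mul

/-- A tuple of multiplicative elements `g i : A ⟶ H` in which a product in increasing order is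
rewritten by means of `R` as a product in decreasing order. -/
structure IsOrdered (H : ElementMonoid C) {n : ℕ} (g : Fin n → H.El A) : Prop where
  one : ∀ i, H.pull Q.unit (g i) = H.one
  mul : ∀ i, H.pull Q.mult (g i) = H.mul (g i) (g i)
  comm : ∀ i j, i < j → H.mul (g i) (g j) = H.pull Q.R.hom (H.mul (g j) (g i))

/-- Moves the last factor `A` in front of the others by means of `R`. -/
def powSwap : (n : ℕ) → (tensorPow A n ⊗ A ⟶ A ⊗ tensorPow A n)
  | 0 => (λ_ A).hom ≫ (ρ_ A).inv
  | n + 1 => (α_ A (tensorPow A n) A).hom ≫ A ◁ powSwap n ≫ (α_ A A (tensorPow A n)).inv ≫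
      Q.R.hom ▷ tensorPow A n ≫ (α_ A A (tensorPow A n)).hom

/-- The multiplication of the tensor power: the first factor of the second word is moved by
`powSwap` next to the first factor of the first word and multiplied with it. -/
def powMul : (n : ℕ) → (tensorPow A n ⊗ tensorPow A n ⟶ tensorPow A n)
  | 0 => (λ_ (𝟙_ C)).hom
  | n + 1 => (α_ A (tensorPow A n) (A ⊗ tensorPow A n)).hom ≫
      A ◁ ((α_ (tensorPow A n) A (tensorPow A n)).inv ≫ Q.powSwap n ▷ tensorPow A n ≫
        (α_ A (tensorPow A n) (tensorPow A n)).hom ≫ A ◁ powMul n) ≫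
      (α_ A A (tensorPow A n)).inv ≫ Q.mult ▷ tensorPow A n

/-- The unit of the tensor power. -/
def powOne : (n : ℕ) → (𝟙_ C ⟶ tensorPow A n)
  | 0 => 𝟙 (𝟙_ C)
  | n + 1 => (λ_ (𝟙_ C)).inv ≫ (Q.unit ⊗ₘ powOne n)

/-- The inclusion of the factor with index `i`. The factor on the left has the largest index. -/
def powGen : (n : ℕ) → Fin n → (A ⟶ tensorPow A n)
  | 0 => Fin.elim0
  | n + 1 => Fin.lastCases ((ρ_ A).inv ≫ A ◁ Q.powOne n)
      (fun i => (λ_ A).inv ≫ (Q.unit ⊗ₘ powGen n i))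

variable {Q} {H : ElementMonoid C} {n : ℕ} {g : Fin n → H.El A}

/-- The morphism `powSwap` moves `x` past a decreasing product, for every `H`. -/
lemma mul_descProd_eq_pull_powSwap : ∀ {n : ℕ} {g : Fin n → H.El A} {x : H.El A}
    (_ : ∀ i, H.mul (g i) x = H.pull Q.R.hom (H.mul x (g i))),
    H.mul (H.descProd g) x = H.pull (Q.powSwap n) (H.mul x (H.descProd g))
  | 0, g, x, _ => by
    simp only [descProd, powSwap, H.one_mul, H.pull_comp]
    rw [H.pull_rightUnitor_inv]
  | n + 1, g, x, hx => by
    have ih := mul_descProd_eq_pull_powSwap (g := fun i => g i.castSucc) (fun i => hx i.castSucc)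
    simp only [descProd, powSwap, H.pull_comp]
    rw [H.mul_assoc, ih, ← H.pull_whiskerLeft, H.pull_assoc_hom, H.pull_whiskerRight, ← hx,
      H.pull_assoc_inv]

namespace IsOrdered

lemma castSucc {g : Fin (n + 1) → H.El A} (hg : Q.IsOrdered H g) :
    Q.IsOrdered H (fun i : Fin n => g i.castSucc) :=
  ⟨fun _ => hg.one _, fun _ => hg.mul _, fun _ _ hij => hg.comm _ _ hij⟩

/-- Ordered tuples may be reindexed along monotone maps; where the map identifies two indices this
uses `μ R = μ`. -/
lemma comp_monotone (hg : Q.IsOrdered H g) {m : ℕ} {f : Fin m → Fin n} (hf : Monotone f) :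
    Q.IsOrdered H (fun i => g (f i)) where
  one _ := hg.one _
  mul _ := hg.mul _
  comm i j hij := by
    rcases (hf hij.le).lt_or_eq with h | h
    · exact hg.comm _ _ h
    · rw [h, ← hg.mul, ← H.pull_comp, Q.comm]

/-- The morphism `powOne` represents the unit of `H`, for every `H` and every ordered tuple. -/
lemma pull_powOne : ∀ {n : ℕ} {g : Fin n → H.El A} (_ : Q.IsOrdered H g),
    H.pull (Q.powOne n) (H.descProd g) = H.one
  | 0, _, _ => by simp only [descProd, powOne, H.pull_id]
  | n + 1, g, hg => by
    simp only [descProd, powOne, H.pull_comp]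
    rw [H.pull_tensor, hg.one, pull_powOne hg.castSucc, H.pull_leftUnitor_inv]

/-- The morphism `powGen n i` represents `g i`, for every `H` and every ordered tuple. -/
lemma pull_powGen : ∀ {n : ℕ} {g : Fin n → H.El A} (_ : Q.IsOrdered H g) (i : Fin n),
    H.pull (Q.powGen n i) (H.descProd g) = g i
  | n + 1, g, hg, i => by
    simp only [descProd, powGen]
    induction i using Fin.lastCases with
    | last =>
      rw [Fin.lastCases_last, H.pull_comp, H.pull_whiskerLeft, hg.castSucc.pull_powOne,
        H.pull_rightUnitor_inv]
    | cast i =>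
      rw [Fin.lastCases_castSucc, H.pull_comp, H.pull_tensor, hg.one, pull_powGen hg.castSucc,
        H.pull_leftUnitor_inv]

/-- The product of two decreasing products is again a decreasing product, and the morphism `powMul`
which rewrites it depends neither on `H` nor on the ordered tuple. -/
lemma descProd_mul_descProd : ∀ {n : ℕ} {g : Fin n → H.El A} (_ : Q.IsOrdered H g),
    H.mul (H.descProd g) (H.descProd g) = H.pull (Q.powMul n) (H.descProd g)
  | 0, _, _ => by simp only [descProd, powMul, H.one_mul]
  | n + 1, g, hg => by
    have hs := mul_descProd_eq_pull_powSwap (fun i => hg.comm _ _ (Fin.castSucc_lt_last i))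
    simp only [descProd, powMul, H.pull_comp]
    rw [H.pull_whiskerRight, hg.mul, H.pull_assoc_inv, H.pull_whiskerLeft]
    simp only [H.pull_comp]
    rw [H.pull_whiskerLeft, ← descProd_mul_descProd hg.castSucc, H.pull_assoc_hom,
      H.pull_whiskerRight, ← hs, H.pull_assoc_inv, H.pull_assoc_hom]

end IsOrdered

/-! ### The regular representation of the tensor powers -/

section Representation

variable (Q)

/-- The action of `A` on `A ⊗ V` which moves past the factor `A` by means of `R` and then acts
on `V`. -/
def shiftAction {V : C} (x : (ofObj V).El A) : (ofObj (A ⊗ V)).El A :=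
  (α_ A A V).inv ≫ Q.R.hom ▷ V ≫ (α_ A A V).hom ≫ A ◁ x

/-- The action of `A` on `A ⊗ V` by multiplication on the first factor. -/
def topAction (V : C) : (ofObj (A ⊗ V)).El A :=
  (α_ A A V).inv ≫ Q.mult ▷ V

/-- The map `ι ⊗ V : V ⟶ A ⊗ V`, up to the unitor. -/
def insertUnit (V : C) : V ⟶ A ⊗ V := (λ_ V).inv ≫ Q.unit ▷ V

variable {Q}

lemma insertUnit_topAction (V : C) : A ◁ Q.insertUnit V ≫ Q.topAction V = 𝟙 (A ⊗ V) := by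
  let _ := Q.toMonObj
  have h : A ◁ Q.unit ≫ Q.mult = (ρ_ A).hom := MonObj.mul_one A
  simp only [insertUnit, topAction, MonoidalCategory.whiskerLeft_comp, Category.assoc]
  rw [associator_inv_naturality_middle_assoc, ← comp_whiskerRight, h]
  simp

/-- The shifted actions commute with the insertion of a unit, by `R (I ⊗ ι) = ι ⊗ I`. -/
lemma insertUnit_shiftAction {V : C} (x : (ofObj V).El A) :
    A ◁ Q.insertUnit V ≫ Q.shiftAction x = x ≫ Q.insertUnit V := by
  have h : A ◁ Q.unit ≫ Q.R.hom = (ρ_ A).hom ≫ (λ_ A).inv ≫ Q.unit ▷ A := by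
    rw [← Q.one_right, Iso.hom_inv_id_assoc]
  simp only [insertUnit, shiftAction, MonoidalCategory.whiskerLeft_comp, Category.assoc]
  rw [associator_inv_naturality_middle_assoc, ← comp_whiskerRight_assoc, h]
  rw [comp_whiskerRight, comp_whiskerRight, Category.assoc, Category.assoc,
    associator_naturality_left_assoc, ← whisker_exchange, leftUnitor_inv_naturality_assoc]
  simp

lemma pull_unit_shiftAction {V : C} {x : (ofObj V).El A}
    (hx : (ofObj V).pull Q.unit x = (ofObj V).one) :
    (ofObj (A ⊗ V)).pull Q.unit (Q.shiftAction x) = (ofObj (A ⊗ V)).one := by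
  have h : Q.unit ▷ A ≫ Q.R.hom = (λ_ A).hom ≫ (ρ_ A).inv ≫ A ◁ Q.unit := by
    rw [← Q.one_left, Iso.hom_inv_id_assoc]
  simp only [ofObj] at hx ⊢
  simp only [shiftAction]
  rw [associator_inv_naturality_left_assoc, ← comp_whiskerRight_assoc, h]
  simp only [comp_whiskerRight, Category.assoc, associator_naturality_middle_assoc]
  rw [← MonoidalCategory.whiskerLeft_comp, hx]
  simp

lemma pull_unit_topAction (V : C) :
    (ofObj (A ⊗ V)).pull Q.unit (Q.topAction V) = (ofObj (A ⊗ V)).one := by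
  let _ := Q.toMonObj
  have h : Q.unit ▷ A ≫ Q.mult = (λ_ A).hom := MonObj.one_mul A
  simp only [topAction]
  rw [associator_inv_naturality_left_assoc, ← comp_whiskerRight, h]
  simp

lemma pull_mult_topAction (V : C) :
    (ofObj (A ⊗ V)).pull Q.mult (Q.topAction V) =
      (ofObj (A ⊗ V)).mul (Q.topAction V) (Q.topAction V) := by
  let _ := Q.toMonObj
  have h : Q.mult ▷ A ≫ Q.mult = (α_ A A A).hom ≫ A ◁ Q.mult ≫ Q.mult := MonObj.mul_assoc A
  simp only [topAction]
  rw [associator_inv_naturality_left_assoc, ← comp_whiskerRight, h]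
  simp

/-- `R` acting on the first two factors of `A ⊗ (A ⊗ V)`. -/
def swapHead (Q : QuasiCommutativeStructure A) (V : C) : A ⊗ (A ⊗ V) ⟶ A ⊗ (A ⊗ V) :=
  (α_ A A V).inv ≫ Q.R.hom ▷ V ≫ (α_ A A V).hom

lemma swapHead_naturality {V W : C} (f : V ⟶ W) :
    Q.swapHead V ≫ A ◁ (A ◁ f) = A ◁ (A ◁ f) ≫ Q.swapHead W := by
  rw [swapHead, swapHead, Category.assoc, Category.assoc, ← associator_naturality_right,
    ← whisker_exchange_assoc, associator_inv_naturality_right_assoc]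

lemma onFirstTwo_whiskerRight (V : C) :
    onFirstTwo Q.R.hom ▷ V = (α_ A (A ⊗ A) V).hom ≫ A ◁ (α_ A A V).hom ≫ Q.swapHead (A ⊗ V) ≫
      A ◁ (α_ A A V).inv ≫ (α_ A (A ⊗ A) V).inv := by
  simp [swapHead, onFirstTwo]

lemma onLastTwo_whiskerRight (V : C) :
    onLastTwo Q.R.hom ▷ V = (α_ A (A ⊗ A) V).hom ≫ A ◁ (α_ A A V).hom ≫ A ◁ Q.swapHead V ≫
      A ◁ (α_ A A V).inv ≫ (α_ A (A ⊗ A) V).inv := by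
  simp [swapHead, onLastTwo]

/-- The Yang-Baxter equation, tensored with `V`. -/
lemma swapHead_yang_baxter (V : C) :
    Q.swapHead (A ⊗ V) ≫ A ◁ Q.swapHead V ≫ Q.swapHead (A ⊗ V) =
      A ◁ Q.swapHead V ≫ Q.swapHead (A ⊗ V) ≫ A ◁ Q.swapHead V := by
  have h := congrArg (fun f => f ▷ V) Q.yang_baxter
  simp only [comp_whiskerRight, onFirstTwo_whiskerRight, onLastTwo_whiskerRight, Category.assoc,
    Iso.inv_hom_id_assoc, whiskerLeft_inv_hom_assoc, Iso.cancel_iso_hom_left] at h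
  simpa only [← Category.assoc, Iso.cancel_iso_inv_right, cancel_mono, cancel_epi] using
    (cancel_epi _).1 h

/-- The axiom `R (μ ⊗ I) = (I ⊗ μ)(R ⊗ I)(I ⊗ R)`, tensored with `V`. -/
lemma topAction_swapHead (V : C) :
    Q.topAction (A ⊗ V) ≫ Q.swapHead V =
      A ◁ Q.swapHead V ≫ Q.swapHead (A ⊗ V) ≫ A ◁ Q.topAction V := by
  have h := congrArg (fun f => A ◁ (α_ A A V).inv ≫ (α_ A (A ⊗ A) V).inv ≫ f ▷ V ≫ (α_ A A V).hom)
    Q.mul_left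
  simp only [comp_whiskerRight, onFirstTwo_whiskerRight, onLastTwo_whiskerRight, Category.assoc,
    Iso.inv_hom_id_assoc, whiskerLeft_inv_hom_assoc] at h
  simpa [swapHead, topAction] using h

/-- The axiom `R (I ⊗ μ) = (μ ⊗ I)(I ⊗ R)(R ⊗ I)`, tensored with `V`. -/
lemma whiskerLeft_topAction_swapHead (V : C) :
    A ◁ Q.topAction V ≫ Q.swapHead V =
      Q.swapHead (A ⊗ V) ≫ A ◁ Q.swapHead V ≫ Q.topAction (A ⊗ V) := by
  have h := congrArg (fun f => A ◁ (α_ A A V).inv ≫ (α_ A (A ⊗ A) V).inv ≫ f ▷ V ≫ (α_ A A V).hom)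
    Q.mul_right
  simp only [comp_whiskerRight, onFirstTwo_whiskerRight, onLastTwo_whiskerRight, Category.assoc,
    Iso.inv_hom_id_assoc, whiskerLeft_inv_hom_assoc] at h
  simpa [swapHead, topAction] using h

lemma mul_ofObj {V X Y : C} (x : (ofObj V).El X) (y : (ofObj V).El Y) :
    (ofObj V).mul x y = (α_ X Y V).hom ≫ X ◁ y ≫ x := rfl

/-- The shift of a module structure is a module structure, by the compatibility of `R` with `μ`. -/
lemma pull_mult_shiftAction {V : C} {x : (ofObj V).El A}
    (hx : (ofObj V).pull Q.mult x = (ofObj V).mul x x) :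
    (ofObj (A ⊗ V)).pull Q.mult (Q.shiftAction x) =
      (ofObj (A ⊗ V)).mul (Q.shiftAction x) (Q.shiftAction x) := by
  have hx' : Q.topAction V ≫ x = A ◁ x ≫ x := by
    rw [topAction, Category.assoc]
    dsimp only at hx
    rw [hx, Iso.inv_hom_id_assoc]
  have hs : Q.shiftAction x = Q.swapHead V ≫ A ◁ x := by simp [shiftAction, swapHead]
  rw [← cancel_epi (α_ A A (A ⊗ V)).inv, mul_ofObj, Iso.inv_hom_id_assoc, hs,
    ← Category.assoc]
  change Q.topAction (A ⊗ V) ≫ _ = _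
  rw [← Category.assoc, topAction_swapHead, MonoidalCategory.whiskerLeft_comp, Category.assoc,
    Category.assoc, Category.assoc, ← MonoidalCategory.whiskerLeft_comp, hx',
    ← Category.assoc (A ◁ (A ◁ x)), ← swapHead_naturality]
  simp

/-- The shift preserves the sorting relation, by the Yang-Baxter equation. -/
lemma shiftAction_mul_shiftAction {V : C} {x y : (ofObj V).El A}
    (hxy : (ofObj V).mul x y = (ofObj V).pull Q.R.hom ((ofObj V).mul y x)) :
    (ofObj (A ⊗ V)).mul (Q.shiftAction x) (Q.shiftAction y) =
      (ofObj (A ⊗ V)).pull Q.R.hom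
        ((ofObj (A ⊗ V)).mul (Q.shiftAction y) (Q.shiftAction x)) := by
  have hs (x : (ofObj V).El A) : Q.shiftAction x = Q.swapHead V ≫ A ◁ x := by
    simp [shiftAction, swapHead]
  have h' : A ◁ y ≫ x = Q.swapHead V ≫ A ◁ x ≫ y := by
    dsimp only at hxy
    rw [swapHead, Category.assoc, Category.assoc, ← hxy, Iso.inv_hom_id_assoc]
  have key : A ◁ Q.shiftAction y ≫ Q.shiftAction x =
      Q.swapHead (A ⊗ V) ≫ A ◁ Q.shiftAction x ≫ Q.shiftAction y := by
    simp only [hs, MonoidalCategory.whiskerLeft_comp, Category.assoc]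
    rw [← Category.assoc (A ◁ (A ◁ y)), ← swapHead_naturality, ← Category.assoc (A ◁ (A ◁ x)),
      ← swapHead_naturality]
    simp only [Category.assoc, ← MonoidalCategory.whiskerLeft_comp]
    rw [h']
    simp only [MonoidalCategory.whiskerLeft_comp]
    have := Q.swapHead_yang_baxter V
    simp only [← Category.assoc] at this ⊢
    rw [this]
  rw [mul_ofObj, mul_ofObj, key]
  simp [swapHead]

/-- The sorting relation between a shifted action and the multiplication on the first factor, by the
compatibility of `R` with `μ`. -/
lemma shiftAction_mul_topAction {V : C} (x : (ofObj V).El A) :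
    (ofObj (A ⊗ V)).mul (Q.shiftAction x) (Q.topAction V) =
      (ofObj (A ⊗ V)).pull Q.R.hom
        ((ofObj (A ⊗ V)).mul (Q.topAction V) (Q.shiftAction x)) := by
  have hs (x : (ofObj V).El A) : Q.shiftAction x = Q.swapHead V ≫ A ◁ x := by
    simp [shiftAction, swapHead]
  have ht : A ◁ (A ◁ x) ≫ Q.topAction V = Q.topAction (A ⊗ V) ≫ A ◁ x := by
    rw [topAction, topAction, associator_inv_naturality_right_assoc, whisker_exchange,
      Category.assoc]
  have key : A ◁ Q.topAction V ≫ Q.shiftAction x =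
      Q.swapHead (A ⊗ V) ≫ A ◁ Q.shiftAction x ≫ Q.topAction V := by
    simp only [hs, MonoidalCategory.whiskerLeft_comp, Category.assoc, ht]
    have := Q.whiskerLeft_topAction_swapHead V
    simp only [← Category.assoc] at this ⊢
    rw [this]
  rw [mul_ofObj, mul_ofObj, key]
  simp [swapHead]

variable (Q) in
/-- The actions on `tensorPow A n` by which the `n` generators multiply from the left: the one with
the largest index multiplies the first factor, the others are moved past it by `R`. That these
actions form an ordered tuple does not involve associativity of `powMul`. -/
def regularAction : (n : ℕ) → Fin n → (ofObj (tensorPow A n)).El A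
  | 0 => Fin.elim0
  | n + 1 => Fin.lastCases (Q.topAction _) (fun i => Q.shiftAction (regularAction n i))

lemma isOrdered_regularAction : ∀ n, Q.IsOrdered (ofObj (tensorPow A n)) (Q.regularAction n)
  | 0 => ⟨fun i => i.elim0, fun i => i.elim0, fun i => i.elim0⟩
  | n + 1 => by
    have ih := isOrdered_regularAction n
    refine ⟨fun i => ?_, fun i => ?_, fun i j hij => ?_⟩
    · induction i using Fin.lastCases with
      | last => simpa only [regularAction, Fin.lastCases_last] using pull_unit_topAction _
      | cast i =>
        simpa only [regularAction, Fin.lastCases_castSucc] using pull_unit_shiftAction (ih.one i)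
    · induction i using Fin.lastCases with
      | last => simpa only [regularAction, Fin.lastCases_last] using pull_mult_topAction _
      | cast i =>
        simpa only [regularAction, Fin.lastCases_castSucc] using pull_mult_shiftAction (ih.mul i)
    · induction i using Fin.lastCases with
      | last => exact absurd hij (Fin.le_last j).not_gt
      | cast i =>
        induction j using Fin.lastCases with
        | last =>
          simpa only [regularAction, Fin.lastCases_last, Fin.lastCases_castSucc] using
            shiftAction_mul_topAction _
        | cast j =>
          simpa only [regularAction, Fin.lastCases_castSucc] using
            shiftAction_mul_shiftAction (ih.comm i j hij)

lemma insertUnit_descProd_shiftAction {V : C} : ∀ {n : ℕ} (x : Fin n → (ofObj V).El A),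
    tensorPow A n ◁ Q.insertUnit V ≫ (ofObj (A ⊗ V)).descProd (fun i => Q.shiftAction (x i)) =
      (ofObj V).descProd x ≫ Q.insertUnit V
  | 0, x => by
    simp only [descProd]
    exact leftUnitor_naturality _
  | n + 1, x => by
    have ih := insertUnit_descProd_shiftAction (fun i => x i.castSucc)
    simp only [descProd]
    rw [associator_naturality_right_assoc, ← MonoidalCategory.whiskerLeft_comp_assoc, ih]
    simp [insertUnit_shiftAction]

/-- The decreasing product of the actions takes the unit of `tensorPow A n` to the identity: an
element of `tensorPow A n` is recovered from its action on the unit. -/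
lemma powOne_descProd_regularAction : ∀ n : ℕ,
    (ρ_ _).inv ≫ tensorPow A n ◁ Q.powOne n ≫ (ofObj (tensorPow A n)).descProd (Q.regularAction n) =
      𝟙 (tensorPow A n)
  | 0 => by
    simp only [powOne, descProd]
    simp [unitors_equal]
  | n + 1 => by
    have ih := powOne_descProd_regularAction n
    have h1 : Q.powOne (n + 1) = Q.powOne n ≫ Q.insertUnit _ := by
      simp only [powOne, insertUnit]
      rw [tensorHom_def', leftUnitor_inv_naturality_assoc]
    have h2 := insertUnit_descProd_shiftAction (Q := Q) (Q.regularAction n)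
    simp only [descProd, regularAction, Fin.lastCases_last, Fin.lastCases_castSucc, h1]
    rw [MonoidalCategory.whiskerLeft_comp, Category.assoc,
      associator_naturality_right_assoc, ← MonoidalCategory.whiskerLeft_comp_assoc, h2,
      MonoidalCategory.whiskerLeft_comp, Category.assoc, insertUnit_topAction, Category.comp_id,
      associator_naturality_right_assoc, ← MonoidalCategory.whiskerLeft_comp]
    rw [show (ρ_ (A ⊗ tensorPow A n)).inv = A ◁ (ρ_ (tensorPow A n)).inv ≫ (α_ _ _ _).inv by simp,
      Category.assoc, Iso.inv_hom_id_assoc, ← MonoidalCategory.whiskerLeft_comp, ih,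
      MonoidalCategory.whiskerLeft_id]

/-- The regular representation is faithful. -/
lemma pull_descProd_regularAction_injective {n : ℕ} {X : C} {a b : X ⟶ tensorPow A n}
    (h : (ofObj _).pull a ((ofObj _).descProd (Q.regularAction n)) =
      (ofObj _).pull b ((ofObj _).descProd (Q.regularAction n))) : a = b := by
  have key (a : X ⟶ tensorPow A n) : a = (ρ_ X).inv ≫ X ◁ Q.powOne n ≫
      (ofObj _).pull a ((ofObj _).descProd (Q.regularAction n)) := by
    rw [whisker_exchange_assoc, ← rightUnitor_inv_naturality_assoc, powOne_descProd_regularAction,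
      Category.comp_id]
  rw [key a, h, ← key b]

end Representation

end QuasiCommutativeStructure

/-! ### Products of lists and families -/

namespace ElementMonoid

variable {H H' : ElementMonoid C}

lemma map_descProd {A : C} (φ : ∀ {X : C}, H.El X → H'.El X) (h1 : φ H.one = H'.one)
    (hmul : ∀ {X Y : C} (x : H.El X) (y : H.El Y), φ (H.mul x y) = H'.mul (φ x) (φ y)) :
    ∀ {n : ℕ} (g : Fin n → H.El A), φ (H.descProd g) = H'.descProd (fun i => φ (g i))
  | 0, _ => h1
  | n + 1, g => by rw [descProd, hmul, map_descProd φ h1 hmul, descProd]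

/-- The product of a list of elements. -/
def listProd (H : ElementMonoid C) {A : C} : (l : List (H.El A)) → H.El (tensorPow A l.length)
  | [] => H.one
  | a :: l => H.mul a (listProd H l)

/-- The product of a finite family of elements, on the tensor product `tensorFamily`. -/
def familyProd (H : ElementMonoid C) :
    {m : ℕ} → {X : Fin m → C} → (∀ i, H.El (X i)) → H.El (tensorFamily X)
  | 0, _, _ => H.one
  | _ + 1, _, x => H.mul (x 0) (familyProd H (fun i => x i.succ))

/-- `x` is the pullback of `y` along an isomorphism. -/
def IsoRel (H : ElementMonoid C) {X Y : C} (x : H.El X) (y : H.El Y) : Prop :=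
  ∃ θ : X ≅ Y, H.pull θ.hom y = x

namespace IsoRel

variable {X Y Z W : C}

lemma refl (x : H.El X) : H.IsoRel x x := ⟨Iso.refl X, H.pull_id x⟩

lemma symm {x : H.El X} {y : H.El Y} : H.IsoRel x y → H.IsoRel y x := by
  rintro ⟨θ, rfl⟩
  exact ⟨θ.symm, by rw [← H.pull_comp, Iso.symm_hom, θ.inv_hom_id, H.pull_id]⟩

lemma trans {x : H.El X} {y : H.El Y} {z : H.El Z} :
    H.IsoRel x y → H.IsoRel y z → H.IsoRel x z := by
  rintro ⟨θ, rfl⟩ ⟨θ', rfl⟩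
  exact ⟨θ ≪≫ θ', H.pull_comp _ _ _⟩

lemma mul {x : H.El X} {y : H.El Y} {z : H.El Z} {w : H.El W} :
    H.IsoRel x y → H.IsoRel z w → H.IsoRel (H.mul x z) (H.mul y w) := by
  rintro ⟨θ, rfl⟩ ⟨θ', rfl⟩
  exact ⟨θ ⊗ᵢ θ', H.pull_tensor _ _ _ _⟩

lemma mul_assoc (x : H.El X) (y : H.El Y) (z : H.El Z) :
    H.IsoRel (H.mul (H.mul x y) z) (H.mul x (H.mul y z)) :=
  ⟨α_ X Y Z, (H.mul_assoc x y z).symm⟩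

lemma one_mul (x : H.El X) : H.IsoRel (H.mul H.one x) x := ⟨λ_ X, (H.one_mul x).symm⟩

lemma mul_one (x : H.El X) : H.IsoRel (H.mul x H.one) x := ⟨ρ_ X, (H.mul_one x).symm⟩

lemma isIso {M : Mon C} {x : X ⟶ M.X} {y : Y ⟶ M.X} (h : (ofMon M).IsoRel x y)
    (_ : IsIso y) : IsIso x := by
  obtain ⟨θ, rfl⟩ := h
  dsimp only
  infer_instance

end IsoRel

variable {A : C}

lemma listProd_append : ∀ l l' : List (H.El A),
    H.IsoRel (H.listProd (l ++ l')) (H.mul (H.listProd l) (H.listProd l'))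
  | [], _ => (IsoRel.one_mul _).symm
  | a :: l, l' => ((IsoRel.refl a).mul (listProd_append l l')).trans (IsoRel.mul_assoc _ _ _).symm

/-- If any two members commute up to an isomorphism, the product of a list does not depend on the
order, up to an isomorphism. -/
lemma listProd_perm {l l' : List (H.El A)} (h : l.Perm l')
    (hc : ∀ x ∈ l, ∀ y ∈ l, H.IsoRel (H.mul x y) (H.mul y x)) :
    H.IsoRel (H.listProd l) (H.listProd l') := by
  induction h with
  | nil => exact IsoRel.refl _
  | cons a _ ih =>
    exact (IsoRel.refl a).mul
      (ih fun x hx y hy => hc x (List.mem_cons_of_mem _ hx) y (List.mem_cons_of_mem _ hy))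
  | swap a b l =>
    exact ((IsoRel.mul_assoc _ _ _).symm.trans
      ((hc b (by simp) a (by simp)).mul (IsoRel.refl _))).trans (IsoRel.mul_assoc _ _ _)
  | trans h1 _ ih1 ih2 =>
    exact (ih1 hc).trans (ih2 fun x hx y hy => hc x (h1.mem_iff.2 hx) y (h1.mem_iff.2 hy))

lemma descProd_isoRel_listProd : ∀ {n : ℕ} (g : Fin n → H.El A),
    H.IsoRel (H.descProd g) (H.listProd ((List.finRange n).reverse.map g))
  | 0, _ => IsoRel.refl _
  | n + 1, g => by
    have ih := descProd_isoRel_listProd (fun i => g i.castSucc)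
    have h : (List.finRange (n + 1)).reverse.map g =
        g (Fin.last n) :: (List.finRange n).reverse.map (fun i => g i.castSucc) := by
      simp [List.finRange_succ_last, Function.comp_def]
    rw [h]
    exact (IsoRel.refl _).mul ih

lemma familyProd_isoRel_flatten : ∀ {m : ℕ} {X : Fin m → C} (x : ∀ i, H.El (X i))
    (l : Fin m → List (H.El A)) (_ : ∀ i, H.IsoRel (x i) (H.listProd (l i))),
    H.IsoRel (H.familyProd x) (H.listProd (List.ofFn l).flatten)
  | 0, _, _, _, _ => IsoRel.refl _
  | m + 1, X, x, l, h => by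
    rw [List.ofFn_succ, List.flatten_cons]
    exact ((h 0).mul (familyProd_isoRel_flatten _ _ fun i => h i.succ)).trans
      (listProd_append _ _).symm

lemma familyProd_isoRel_ofFn {m : ℕ} {X : Fin m → C} (x : ∀ i, H.El (X i))
    (y : Fin m → H.El A) (h : ∀ i, H.IsoRel (x i) (y i)) :
    H.IsoRel (H.familyProd x) (H.listProd (List.ofFn y)) := by
  have := familyProd_isoRel_flatten x (fun i => [y i])
    fun i => (h i).trans (IsoRel.mul_one _).symm
  rwa [show (List.ofFn fun i => [y i]).flatten = List.ofFn y by
    rw [show (fun i => [y i]) = (fun a => [a]) ∘ y from rfl, ← List.map_ofFn, ← List.flatMap_def,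
      List.flatMap_singleton']] at this

end ElementMonoid

lemma tensorFamilyMap_iteratedMul (M : Mon C) : ∀ {m : ℕ} {X : Fin m → C} (x : ∀ i, X i ⟶ M.X),
    tensorFamilyMap x ≫ iteratedMul M m = (ofMon M).familyProd x
  | 0, _, _ => Category.id_comp _
  | m + 1, X, x => by
    have ih := tensorFamilyMap_iteratedMul M (fun i => x i.succ)
    change (x 0 ⊗ₘ tensorFamilyMap fun i => x i.succ) ≫ M.X ◁ iteratedMul M m ≫ MonObj.mul =
      (x 0 ⊗ₘ (ofMon M).familyProd fun i => x i.succ) ≫ MonObj.mul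
    rw [← ih, ← id_tensorHom, tensorHom_comp_tensorHom_assoc, Category.comp_id]

lemma ofMon_map_descProd {A : C} {M B : Mon C} (f : M ⟶ B) {n : ℕ} (g : Fin n → (A ⟶ M.X)) :
    (ofMon M).descProd g ≫ f.hom = (ofMon B).descProd (fun i => g i ≫ f.hom) :=
  map_descProd (H := ofMon M) (H' := ofMon B) (fun x => x ≫ f.hom) (IsMonHom.one_hom f.hom)
    (fun x y => by simp) g

lemma FinOrdinal.monotone_toFun {N : ℕ∞} {m n : FinOrdinal N} (f : m ⟶ n) :
    Monotone (FinOrdinal.toFun f) :=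
  (show Fin m.card →o Fin n.card from f).monotone

namespace QuasiCommutativeStructure

variable {A : C} (Q : QuasiCommutativeStructure A)

/-! ### The universal monoid with an ordered tuple -/

/-- The monoid structure on the tensor power. Its axioms hold because the regular representation is
faithful and turns `powMul` and `powOne` into the multiplication and the unit of elements. -/
@[reducible]
def powMon (n : ℕ) : Mon C where
  X := tensorPow A n
  mon :=
    let H := ofObj (tensorPow A n)
    have hQ := Q.isOrdered_regularAction n
    { one := Q.powOne n
      mul := Q.powMul n
      one_mul := pull_descProd_regularAction_injective (Q := Q) <| by
        rw [H.pull_comp, ← hQ.descProd_mul_descProd, H.pull_whiskerRight, hQ.pull_powOne, H.one_mul]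
      mul_one := pull_descProd_regularAction_injective (Q := Q) <| by
        rw [H.pull_comp, ← hQ.descProd_mul_descProd, H.pull_whiskerLeft, hQ.pull_powOne, H.mul_one]
      mul_assoc := pull_descProd_regularAction_injective (Q := Q) <| by
        rw [H.pull_comp, H.pull_comp, H.pull_comp, ← hQ.descProd_mul_descProd, H.pull_whiskerRight,
          H.pull_whiskerLeft, ← hQ.descProd_mul_descProd, H.mul_assoc] }

/-- A monoid with an ordered tuple of generators whose decreasing product is an isomorphism from the
tensor power. It is the universal monoid with an ordered `n`-tuple. -/
structure Model (n : ℕ) where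
  mon : Mon C
  gen : Fin n → (A ⟶ mon.X)
  isOrdered : Q.IsOrdered (ofMon mon) gen
  isIso : IsIso ((ofMon mon).descProd gen)

variable {Q}

namespace Model

variable {n : ℕ} (M : Q.Model n)

attribute [instance] Model.isIso

/-- The homomorphism out of a model given by an ordered tuple. It is multiplicative because products
of decreasing products are rewritten by the same `powMul` in `M` and in `B`. -/
noncomputable def lift {B : Mon C} {g : Fin n → (A ⟶ B.X)} (hg : Q.IsOrdered (ofMon B) g) :
    M.mon ⟶ B :=
  Mon.Hom.mk' (inv ((ofMon M.mon).descProd M.gen) ≫ (ofMon B).descProd g)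
    (by
      have h1 := M.isOrdered.pull_powOne
      have h2 := hg.pull_powOne
      dsimp only at h1 h2
      rw [← h1, Category.assoc, IsIso.hom_inv_id_assoc, h2])
    (by
      have h1 := M.isOrdered.descProd_mul_descProd
      have h2 := hg.descProd_mul_descProd
      dsimp only at h1 h2
      rw [← cancel_epi ((ofMon M.mon).descProd M.gen ⊗ₘ (ofMon M.mon).descProd M.gen),
        ← Category.assoc, h1, tensorHom_comp_tensorHom_assoc, IsIso.hom_inv_id_assoc, h2,
        Category.assoc, IsIso.hom_inv_id_assoc])

lemma descProd_lift {B : Mon C} {g : Fin n → (A ⟶ B.X)} (hg : Q.IsOrdered (ofMon B) g) :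
    (ofMon M.mon).descProd M.gen ≫ (M.lift hg).hom = (ofMon B).descProd g :=
  IsIso.hom_inv_id_assoc _ _

lemma gen_lift {B : Mon C} {g : Fin n → (A ⟶ B.X)} (hg : Q.IsOrdered (ofMon B) g) (i : Fin n) :
    M.gen i ≫ (M.lift hg).hom = g i := by
  rw [← M.isOrdered.pull_powGen i]
  dsimp only
  rw [Category.assoc, descProd_lift]
  exact hg.pull_powGen i

variable {M} in
lemma hom_ext {B : Mon C} {f f' : M.mon ⟶ B} (h : ∀ i, M.gen i ≫ f.hom = M.gen i ≫ f'.hom) :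
    f = f' := by
  apply Mon.Hom.ext
  rw [← cancel_epi ((ofMon M.mon).descProd M.gen), ofMon_map_descProd, ofMon_map_descProd, funext h]

end Model

/-- The regular representation is multiplicative. -/
lemma powMon_pull_mul (n : ℕ) {X Y : C} (x : X ⟶ tensorPow A n) (y : Y ⟶ tensorPow A n) :
    (ofObj (tensorPow A n)).pull ((ofMon (Q.powMon n)).mul x y)
        ((ofObj (tensorPow A n)).descProd (Q.regularAction n)) =
      (ofObj (tensorPow A n)).mul
        ((ofObj (tensorPow A n)).pull x ((ofObj (tensorPow A n)).descProd (Q.regularAction n)))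
        ((ofObj (tensorPow A n)).pull y
          ((ofObj (tensorPow A n)).descProd (Q.regularAction n))) := by
  rw [← ElementMonoid.pull_tensor, (Q.isOrdered_regularAction n).descProd_mul_descProd,
    ← ElementMonoid.pull_comp]
  rfl

variable (Q) in
/-- The tensor power, with the inclusions of its factors, is a model; its decreasing product is the
identity. -/
def powModel (n : ℕ) : Q.Model n where
  mon := Q.powMon n
  gen := Q.powGen n
  isOrdered :=
    let H := ofObj (tensorPow A n)
    have hQ := Q.isOrdered_regularAction n
    { one := fun i => pull_descProd_regularAction_injective (Q := Q) <| by
        rw [H.pull_comp, hQ.pull_powGen, hQ.one]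
        exact hQ.pull_powOne.symm
      mul := fun i => pull_descProd_regularAction_injective (Q := Q) <| by
        rw [powMon_pull_mul, H.pull_comp, hQ.pull_powGen, hQ.mul]
      comm := fun i j hij => pull_descProd_regularAction_injective (Q := Q) <| by
        rw [powMon_pull_mul, H.pull_comp, powMon_pull_mul, hQ.pull_powGen, hQ.pull_powGen,
          hQ.comm i j hij] }
  isIso := by
    let H := ofObj (tensorPow A n)
    have hQ := Q.isOrdered_regularAction n
    have h : (ofMon (Q.powMon n)).descProd (Q.powGen n) = 𝟙 (tensorPow A n) :=
      pull_descProd_regularAction_injective (Q := Q) <| by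
        rw [map_descProd (H := ofMon (Q.powMon n)) (H' := H)
          (fun x => H.pull x (H.descProd (Q.regularAction n))) hQ.pull_powOne (powMon_pull_mul n),
          H.pull_id]
        congr 1
        funext i
        exact hQ.pull_powGen i
    rw [h]
    exact inferInstanceAs (IsIso (𝟙 (tensorPow A n)))

variable (Q) in
/-- The monoid `A` itself is a model of length one. -/
def selfModel : Q.Model 1 where
  mon := { X := A, mon := Q.toMonObj }
  gen _ := 𝟙 A
  isOrdered :=
    { one := fun _ => Category.comp_id _
      mul := fun _ => by simp
      comm := fun i j hij => absurd hij (by omega) }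
  isIso := by
    let _ := Q.toMonObj
    have h : (𝟙 A ⊗ₘ Q.unit) ≫ Q.mult = (ρ_ A).hom := by
      rw [id_tensorHom]
      exact MonObj.mul_one A
    change IsIso ((𝟙 A ⊗ₘ Q.unit) ≫ Q.mult)
    rw [h]
    infer_instance

variable (Q) in
/-- The chosen model of each length. In length one it is `A` and not `A ⊗ 𝟙`, since the component of
length one of the associated cosimplicial monoid has to be equal to `A`. -/
def model : (n : ℕ) → Q.Model n
  | 1 => Q.selfModel
  | n => Q.powModel n

lemma IsOrdered.isoRel_comm {H : ElementMonoid C} {n : ℕ} {g : Fin n → H.El A}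
    (hg : Q.IsOrdered H g) (i j : Fin n) :
    H.IsoRel (H.mul (g i) (g j)) (H.mul (g j) (g i)) := by
  rcases lt_trichotomy i j with h | rfl | h
  · exact ⟨Q.R, (hg.comm _ _ h).symm⟩
  · exact IsoRel.refl _
  · exact IsoRel.symm ⟨Q.R, (hg.comm _ _ h).symm⟩

lemma IsOrdered.descProd_isoRel_of_perm {H : ElementMonoid C} {n : ℕ} {g : Fin n → H.El A}
    (hg : Q.IsOrdered H g) {l : List (Fin n)} (hl : l.Nodup) (hmem : ∀ i, i ∈ l) :
    H.IsoRel (H.listProd (l.map g)) (H.descProd g) := by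
  have hp : l.Perm (List.finRange n).reverse :=
    (List.perm_ext_iff_of_nodup hl (List.nodup_reverse.2 (List.nodup_finRange n))).2
      fun i => by simp [hmem i]
  refine (listProd_perm (hp.map g) fun x hx y hy => ?_).trans (descProd_isoRel_listProd g).symm
  obtain ⟨i, -, rfl⟩ := List.mem_map.1 hx
  obtain ⟨j, -, rfl⟩ := List.mem_map.1 hy
  exact hg.isoRel_comm i j

/-! ### The cosimplicial monoid of a quasi-commutative structure -/

variable (Q) in
/-- The cosimplicial monoid of a quasi-commutative structure: a map of ordinals acts by reindexing
the generators. -/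
noncomputable def cosimplicial (N : ℕ∞) : FinOrdinal N ⥤ Mon C where
  obj n := (Q.model n.card).mon
  map {m n} f := (Q.model m.card).lift
    ((Q.model n.card).isOrdered.comp_monotone (FinOrdinal.monotone_toFun f))
  map_id n := Model.hom_ext fun i => by
    rw [Model.gen_lift, Mon.id_hom', Category.comp_id]
    rfl
  map_comp f g := Model.hom_ext fun i => by
    rw [Model.gen_lift, Mon.comp_hom', ← Category.assoc, Model.gen_lift, Model.gen_lift]
    rfl

/-- A covering map is, up to an isomorphism, a product in some order of all the generators, each
taken once; this differs from the decreasing product by an isomorphism because `R` is invertible. -/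
lemma covering_cosimplicial (N : ℕ∞) : CoveringCondition (Q.cosimplicial N) := by
  intro n m k f hinj hdisj hcov
  rw [coveringMap, tensorFamilyMap_iteratedMul]
  -- `L i` lists the image of `f i` in decreasing order.
  let L : Fin m → List (Fin n.card) := fun i =>
    (List.finRange (k i).card).reverse.map (FinOrdinal.toFun (f i))
  have hx (i : Fin m) : (ofMon (Q.model n.card).mon).IsoRel
      ((Q.cosimplicial N).map (f i)).hom
      ((ofMon (Q.model n.card).mon).listProd ((L i).map (Q.model n.card).gen)) := by
    refine IsoRel.trans (IsoRel.symm ⟨@asIso _ _ _ _ _ (Q.model (k i).card).isIso,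
      (Q.model (k i).card).descProd_lift ((Q.model n.card).isOrdered.comp_monotone
        (FinOrdinal.monotone_toFun (f i)))⟩) ((descProd_isoRel_listProd _).trans ?_)
    rw [List.map_map]
    exact IsoRel.refl _
  have h := familyProd_isoRel_flatten (H := ofMon (Q.model n.card).mon) _ _ hx
  have hflat : (List.ofFn fun i => (L i).map (Q.model n.card).gen).flatten =
      (List.ofFn L).flatten.map (Q.model n.card).gen := by
    rw [List.map_flatten, List.map_ofFn]
    rfl
  rw [hflat] at h
  have hmem (i : Fin m) (a : Fin n.card) : a ∈ L i ↔ a ∈ Set.range (FinOrdinal.toFun (f i)) := by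
    simp [L]
  have hnodup : (List.ofFn L).flatten.Nodup := by
    rw [List.nodup_flatten, List.pairwise_ofFn]
    refine ⟨fun l hl => ?_, fun i j hij a hi hj => ?_⟩
    · obtain ⟨i, rfl⟩ := List.mem_ofFn.1 hl
      exact (List.nodup_reverse.2 (List.nodup_finRange _)).map (hinj i)
    · exact Set.disjoint_left.1 (hdisj i j hij.ne) ((hmem i a).1 hi) ((hmem j a).1 hj)
  have hall (a : Fin n.card) : a ∈ (List.ofFn L).flatten := by
    obtain ⟨i, hi⟩ := Set.mem_iUnion.1 (hcov ▸ Set.mem_univ a : a ∈ ⋃ i, _)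
    exact List.mem_flatten.2 ⟨L i, List.mem_ofFn.2 ⟨i, rfl⟩, (hmem i a).2 hi⟩
  exact (h.trans ((Q.model n.card).isOrdered.descProd_isoRel_of_perm hnodup hall)).isIso
    (Q.model n.card).isIso

variable (Q) in
/-- The cosimplicial monoid of a quasi-commutative structure, with the covering condition. -/
noncomputable def toCosimplicialMonoidOn (N : ℕ∞) (h : 3 ≤ N) : CosimplicialMonoidOn N h A where
  functor := Q.cosimplicial N
  obj_one := rfl
  covering := Q.covering_cosimplicial N

end QuasiCommutativeStructure

/-! ### The quasi-commutative structure of a cosimplicial monoid -/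

/-- The map `[1] ⟶ [n]` with value `i`. -/
def FinOrdinal.point {N : ℕ∞} (h : 3 ≤ N) {n : FinOrdinal N} (i : Fin n.card) :
    FinOrdinal.one h ⟶ n :=
  (⟨fun _ => i, fun _ _ _ => le_rfl⟩ : Fin 1 →o Fin n.card)

/-- The object `[3]`. -/
def FinOrdinal.three {N : ℕ∞} (h : 3 ≤ N) : FinOrdinal N := ⟨3, h⟩

/-- The element of `[1]`. -/
def FinOrdinal.only {N : ℕ∞} (h : 3 ≤ N) : Fin (FinOrdinal.one h).card := (0 : Fin 1)

/-- The first element of `[2]`. -/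
def FinOrdinal.fst {N : ℕ∞} (h : 3 ≤ N) : Fin (FinOrdinal.two h).card := (0 : Fin 2)

/-- The last element of `[2]`. -/
def FinOrdinal.snd {N : ℕ∞} (h : 3 ≤ N) : Fin (FinOrdinal.two h).card := (1 : Fin 2)

lemma FinOrdinal.fst_le_snd {N : ℕ∞} (h : 3 ≤ N) : FinOrdinal.fst h ≤ FinOrdinal.snd h :=
  Fin.zero_le (1 : Fin 2)

lemma FinOrdinal.nodup_snd_fst {N : ℕ∞} (h : 3 ≤ N) :
    [FinOrdinal.snd h, FinOrdinal.fst h].Nodup :=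
  (by decide : [(1 : Fin 2), 0].Nodup)

lemma FinOrdinal.eq_fst_or_snd {N : ℕ∞} (h : 3 ≤ N) :
    ∀ i, i = FinOrdinal.fst h ∨ i = FinOrdinal.snd h :=
  (by decide : ∀ i : Fin 2, i = 0 ∨ i = 1)

section

variable (H : ElementMonoid C) {A : C}

lemma ElementMonoid.pull_onLastTwo (R : A ⊗ A ⟶ A ⊗ A) (x y z : H.El A) :
    H.pull (onLastTwo R) (H.mul x (H.mul y z)) = H.mul x (H.pull R (H.mul y z)) :=
  H.pull_whiskerLeft _ _ _

lemma ElementMonoid.pull_onFirstTwo {R : A ⊗ A ⟶ A ⊗ A} {x y x' y' : H.El A}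
    (h : H.pull R (H.mul x y) = H.mul x' y') (z : H.El A) :
    H.pull (onFirstTwo R) (H.mul x (H.mul y z)) = H.mul x' (H.mul y' z) := by
  rw [onFirstTwo, H.pull_comp, H.pull_comp, H.pull_assoc_hom, H.pull_whiskerRight, h,
    H.pull_assoc_inv]

end

namespace CosimplicialMonoidOn

variable {N : ℕ∞} {h : 3 ≤ N} {A : C} (X : CosimplicialMonoidOn N h A)

/-- The generator `A = A^1 ⟶ A^n` induced by the map `[1] ⟶ [n]` with value `i`. -/
def gen (n : FinOrdinal N) (i : Fin n.card) : A ⟶ (X.functor.obj n).X :=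
  X.isoOne.inv ≫ (X.functor.map (FinOrdinal.point h i)).hom

lemma gen_map {m n : FinOrdinal N} (f : m ⟶ n) (i : Fin m.card) :
    X.gen m i ≫ (X.functor.map f).hom = X.gen n (FinOrdinal.toFun f i) := by
  rw [gen, gen, Category.assoc, ← Mon.comp_hom', ← X.functor.map_comp]
  rfl

lemma gen_one : X.gen (FinOrdinal.one h) (FinOrdinal.only h) = X.isoOne.inv := by
  have : FinOrdinal.point h (FinOrdinal.only h) = 𝟙 _ := by
    apply OrderHom.ext
    funext i
    exact (Fin.fin_one_eq_zero i).symm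
  rw [gen, this, X.functor.map_id, Mon.id_hom', Category.comp_id]

/-- Every product of all the generators of `A^n`, each taken once, is an isomorphism. -/
lemma isIso_listProd (n : FinOrdinal N) {l : List (Fin n.card)} (hl : l.Nodup)
    (hmem : ∀ i, i ∈ l) : IsIso ((ofMon (X.functor.obj n)).listProd (l.map (X.gen n))) := by
  have hc := X.covering n l.length (fun _ => FinOrdinal.one h)
    (fun i => FinOrdinal.point h (l.get i)) (fun i a b _ => Subsingleton.elim (α := Fin 1) a b)
    (fun i j hij => by
      rw [Set.disjoint_left]
      rintro _ ⟨_, rfl⟩ ⟨_, hj⟩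
      exact hij (List.nodup_iff_injective_get.1 hl hj.symm))
    (by
      refine Set.eq_univ_of_forall fun a => ?_
      obtain ⟨i, rfl⟩ := List.mem_iff_get.1 (hmem a)
      exact Set.mem_iUnion.2 ⟨i, FinOrdinal.only h, rfl⟩)
  rw [coveringMap, tensorFamilyMap_iteratedMul] at hc
  have hr := familyProd_isoRel_ofFn (H := ofMon (X.functor.obj n)) _
    (fun i => X.gen n (l.get i)) fun i => IsoRel.symm ⟨X.isoOne.symm, rfl⟩
  have hl' : (List.ofFn fun i => X.gen n (l.get i)) = l.map (X.gen n) := by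
    conv_rhs => rw [← List.ofFn_get l, List.map_ofFn]
    rfl
  rw [hl'] at hr
  exact hr.symm.isIso hc

lemma coface_zero : X.coface 0 = X.gen (FinOrdinal.two h) (FinOrdinal.snd h) := by
  have : FinOrdinal.coface h 0 = FinOrdinal.point h (FinOrdinal.snd h) := by
    apply OrderHom.ext
    funext i
    rw [Subsingleton.elim (α := Fin 1) i 0]
    rfl
  rw [coface, gen, this]

lemma coface_one : X.coface 1 = X.gen (FinOrdinal.two h) (FinOrdinal.fst h) := by
  have : FinOrdinal.coface h 1 = FinOrdinal.point h (FinOrdinal.fst h) := by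
    apply OrderHom.ext
    funext i
    rw [Subsingleton.elim (α := Fin 1) i 0]
    rfl
  rw [coface, gen, this]

lemma mulCofaces_zero_one : X.mulCofaces 0 1 =
    (ofMon (X.functor.obj (FinOrdinal.two h))).mul
      (X.gen (FinOrdinal.two h) (FinOrdinal.snd h))
      (X.gen (FinOrdinal.two h) (FinOrdinal.fst h)) := by
  rw [mulCofaces, coface_zero, coface_one]

lemma mulCofaces_one_zero : X.mulCofaces 1 0 =
    (ofMon (X.functor.obj (FinOrdinal.two h))).mul
      (X.gen (FinOrdinal.two h) (FinOrdinal.fst h))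
      (X.gen (FinOrdinal.two h) (FinOrdinal.snd h)) := by
  rw [mulCofaces, coface_zero, coface_one]

instance : IsIso (X.mulCofaces 0 1) := by
  rw [mulCofaces_zero_one]
  exact IsoRel.isIso ((IsoRel.refl _).mul (IsoRel.mul_one _).symm)
    (X.isIso_listProd (FinOrdinal.two h) (FinOrdinal.nodup_snd_fst h) fun i => by
      rcases FinOrdinal.eq_fst_or_snd h i with rfl | rfl <;> simp)

instance : IsIso (X.mulCofaces 1 0) := by
  rw [mulCofaces_one_zero]
  exact IsoRel.isIso ((IsoRel.refl _).mul (IsoRel.mul_one _).symm)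
    (X.isIso_listProd (FinOrdinal.two h) (List.nodup_reverse.2 (FinOrdinal.nodup_snd_fst h))
      fun i => by rcases FinOrdinal.eq_fst_or_snd h i with rfl | rfl <;> simp)

/-- The operator `R = (μ(∂_0 ⊗ ∂_1))⁻¹ μ(∂_1 ⊗ ∂_0)`. -/
noncomputable def braid : A ⊗ A ≅ A ⊗ A :=
  asIso (X.mulCofaces 1 0) ≪≫ (asIso (X.mulCofaces 0 1)).symm

/-- In `A^2` this is the definition of `R`; the general case is its image under the map `[2] ⟶ [n]`
with values `i` and `j`, which need not be injective. -/
lemma gen_comm (n : FinOrdinal N) {i j : Fin n.card} (hij : i ≤ j) :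
    (ofMon (X.functor.obj n)).mul (X.gen n i) (X.gen n j) =
      X.braid.hom ≫ (ofMon (X.functor.obj n)).mul (X.gen n j) (X.gen n i) := by
  have h2 : X.mulCofaces 1 0 = X.braid.hom ≫ X.mulCofaces 0 1 := by simp [braid]
  rw [mulCofaces_one_zero, mulCofaces_zero_one] at h2
  let f : FinOrdinal.two h ⟶ n := (⟨![i, j], by
    intro a b hab
    fin_cases a <;> fin_cases b <;> simp_all⟩ : Fin 2 →o Fin n.card)
  have h3 := congrArg (fun k => k ≫ (X.functor.map f).hom) h2
  simp only [Category.assoc, IsMonHom.mul_hom, tensorHom_comp_tensorHom_assoc, gen_map] at h3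
  exact h3

lemma unit_gen (n : FinOrdinal N) (i : Fin n.card) :
    X.monObj.one ≫ X.gen n i = MonObj.one := by
  simp only [gen, MonObj.ofIso_one, Category.assoc, Iso.hom_inv_id_assoc, IsMonHom.one_hom]

lemma mult_gen (n : FinOrdinal N) (i : Fin n.card) :
    X.monObj.mul ≫ X.gen n i = (ofMon (X.functor.obj n)).mul (X.gen n i) (X.gen n i) := by
  simp only [gen, MonObj.ofIso_mul, Category.assoc, Iso.hom_inv_id_assoc, IsMonHom.mul_hom,
    tensorHom_comp_tensorHom_assoc]

/-- Maps into `A ⊗ A` may be compared in `A^2`. -/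
lemma eq_of_comp_mul {Y : C} {a b : Y ⟶ A ⊗ A}
    (hab : a ≫ (ofMon (X.functor.obj (FinOrdinal.two h))).mul
        (X.gen (FinOrdinal.two h) (FinOrdinal.snd h))
        (X.gen (FinOrdinal.two h) (FinOrdinal.fst h)) =
      b ≫ (ofMon (X.functor.obj (FinOrdinal.two h))).mul
        (X.gen (FinOrdinal.two h) (FinOrdinal.snd h))
        (X.gen (FinOrdinal.two h) (FinOrdinal.fst h))) :
    a = b := by
  rwa [← mulCofaces_zero_one, cancel_mono] at hab

/-- Maps into `A ⊗ (A ⊗ A)` may be compared in `A^3`. -/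
lemma eq_of_comp_mul_mul {Y : C} {a b : Y ⟶ A ⊗ (A ⊗ A)} :
    let H := ofMon (X.functor.obj (FinOrdinal.three h))
    let e : Fin 3 → (A ⟶ _) := X.gen (FinOrdinal.three h)
    a ≫ H.mul (e 2) (H.mul (e 1) (e 0)) = b ≫ H.mul (e 2) (H.mul (e 1) (e 0)) → a = b := by
  intro H e hab
  have : IsIso (H.mul (e 2) (H.mul (e 1) (e 0))) :=
    IsoRel.isIso ((IsoRel.refl _).mul ((IsoRel.refl _).mul (IsoRel.mul_one _).symm))
      (X.isIso_listProd (FinOrdinal.three h) (by decide : [(2 : Fin 3), 1, 0].Nodup)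
        (by decide : ∀ i : Fin 3, i ∈ [(2 : Fin 3), 1, 0]))
  rwa [cancel_mono] at hab

/-- The quasi-commutative structure of a cosimplicial monoid. Each axiom states that two ways of
sorting a product of generators agree: the Yang-Baxter equation is read off in `A^3`, the
compatibilities with `ι` and `μ` in `A^2`, and `μ R = μ` in `A^1`. -/
noncomputable def toQuasiCommutativeStructure : QuasiCommutativeStructure A where
  toMonObj := X.monObj
  R := X.braid
  yang_baxter := by
    apply X.eq_of_comp_mul_mul
    let H := ofMon (X.functor.obj (FinOrdinal.three h))
    let e : Fin 3 → (A ⟶ _) := X.gen (FinOrdinal.three h)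
    have c01 := X.gen_comm (FinOrdinal.three h) (by decide : (0 : Fin 3) ≤ (1 : Fin 3))
    have c02 := X.gen_comm (FinOrdinal.three h) (by decide : (0 : Fin 3) ≤ (2 : Fin 3))
    have c12 := X.gen_comm (FinOrdinal.three h) (by decide : (1 : Fin 3) ≤ (2 : Fin 3))
    change H.mul (e 0) (e 1) = H.pull _ (H.mul (e 1) (e 0)) at c01
    change H.mul (e 0) (e 2) = H.pull _ (H.mul (e 2) (e 0)) at c02
    change H.mul (e 1) (e 2) = H.pull _ (H.mul (e 2) (e 1)) at c12
    change H.pull _ (H.mul (e 2) (H.mul (e 1) (e 0))) = H.pull _ (H.mul (e 2) (H.mul (e 1) (e 0)))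
    rw [H.pull_comp, H.pull_comp, H.pull_comp, H.pull_comp, H.pull_onLastTwo, ← c01,
      H.pull_onFirstTwo c12.symm, H.pull_onFirstTwo c02.symm, H.pull_onLastTwo, ← c02,
      H.pull_onLastTwo, ← c12, H.pull_onFirstTwo c01.symm]
  one_left := by
    apply X.eq_of_comp_mul
    have c := X.gen_comm (FinOrdinal.two h) (FinOrdinal.fst_le_snd h)
    let H := ofMon (X.functor.obj (FinOrdinal.two h))
    let e0 : H.El A := X.gen _ (FinOrdinal.fst h)
    let e1 : H.El A := X.gen _ (FinOrdinal.snd h)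
    have h0 : H.pull X.monObj.one e0 = H.one := X.unit_gen _ _
    change H.mul e0 e1 = H.pull _ (H.mul e1 e0) at c
    change H.pull _ (H.mul e1 e0) = H.pull _ (H.mul e1 e0)
    rw [H.pull_comp, H.pull_comp, H.pull_comp, ← c, H.pull_whiskerRight, H.pull_whiskerLeft, h0,
      H.pull_leftUnitor_inv, H.pull_rightUnitor_inv]
  one_right := by
    apply X.eq_of_comp_mul
    have c := X.gen_comm (FinOrdinal.two h) (FinOrdinal.fst_le_snd h)
    let H := ofMon (X.functor.obj (FinOrdinal.two h))
    let e0 : H.El A := X.gen _ (FinOrdinal.fst h)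
    let e1 : H.El A := X.gen _ (FinOrdinal.snd h)
    have h1 : H.pull X.monObj.one e1 = H.one := X.unit_gen _ _
    change H.mul e0 e1 = H.pull _ (H.mul e1 e0) at c
    change H.pull _ (H.mul e1 e0) = H.pull _ (H.mul e1 e0)
    rw [H.pull_comp, H.pull_comp, H.pull_comp, ← c, H.pull_whiskerRight, H.pull_whiskerLeft, h1,
      H.pull_leftUnitor_inv, H.pull_rightUnitor_inv]
  mul_right := by
    apply X.eq_of_comp_mul
    have c := X.gen_comm (FinOrdinal.two h) (FinOrdinal.fst_le_snd h)
    let H := ofMon (X.functor.obj (FinOrdinal.two h))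
    let e0 : H.El A := X.gen _ (FinOrdinal.fst h)
    let e1 : H.El A := X.gen _ (FinOrdinal.snd h)
    have h1 : H.pull X.monObj.mul e1 = H.mul e1 e1 := X.mult_gen _ _
    change H.mul e0 e1 = H.pull _ (H.mul e1 e0) at c
    change H.pull _ (H.mul e1 e0) = H.pull _ (H.mul e1 e0)
    rw [H.pull_comp, H.pull_comp, H.pull_comp, H.pull_comp, ← c, H.pull_whiskerRight,
      H.pull_whiskerLeft, h1, H.pull_assoc_inv, H.pull_onLastTwo, ← c,
      H.pull_onFirstTwo c.symm]
  mul_left := by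
    apply X.eq_of_comp_mul
    have c := X.gen_comm (FinOrdinal.two h) (FinOrdinal.fst_le_snd h)
    let H := ofMon (X.functor.obj (FinOrdinal.two h))
    let e0 : H.El A := X.gen _ (FinOrdinal.fst h)
    let e1 : H.El A := X.gen _ (FinOrdinal.snd h)
    have h0 : H.pull X.monObj.mul e0 = H.mul e0 e0 := X.mult_gen _ _
    change H.mul e0 e1 = H.pull _ (H.mul e1 e0) at c
    change H.pull _ (H.mul e1 e0) = H.pull _ (H.mul e1 e0)
    rw [H.pull_comp, H.pull_comp, H.pull_comp, H.pull_comp, ← c, H.pull_whiskerRight,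
      H.pull_whiskerLeft, h0, H.pull_assoc_inv, H.pull_onFirstTwo c.symm, H.pull_onLastTwo, ← c]
  comm := by
    have c := X.gen_comm (FinOrdinal.one h) (le_refl (FinOrdinal.only h))
    rw [← mult_gen, gen_one] at c
    rw [← cancel_mono X.isoOne.inv, Category.assoc, ← c]

/-- Each component of a cosimplicial monoid with the covering condition is a model. -/
def toModel (n : FinOrdinal N) : X.toQuasiCommutativeStructure.Model n.card where
  mon := X.functor.obj n
  gen := X.gen n
  isOrdered := ⟨X.unit_gen n, X.mult_gen n, fun _ _ hij => X.gen_comm n hij.le⟩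
  isIso := (descProd_isoRel_listProd _).isIso
    (X.isIso_listProd n (List.nodup_reverse.2 (List.nodup_finRange _)) (by simp))

variable {X} in
lemma hom_ext_gen {n : FinOrdinal N} {B : Mon C} {f f' : X.functor.obj n ⟶ B}
    (hf : ∀ i, X.gen n i ≫ f.hom = X.gen n i ≫ f'.hom) : f = f' :=
  (X.toModel n).hom_ext hf

/-- The homomorphism out of `A^n` given by an ordered tuple. -/
noncomputable def lift (n : FinOrdinal N) {B : Mon C} {g : Fin n.card → (A ⟶ B.X)}
    (hg : X.toQuasiCommutativeStructure.IsOrdered (ofMon B) g) : X.functor.obj n ⟶ B :=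
  (X.toModel n).lift hg

lemma gen_lift (n : FinOrdinal N) {B : Mon C} {g : Fin n.card → (A ⟶ B.X)}
    (hg : X.toQuasiCommutativeStructure.IsOrdered (ofMon B) g) (i : Fin n.card) :
    X.gen n i ≫ (X.lift n hg).hom = g i :=
  (X.toModel n).gen_lift hg i

end CosimplicialMonoidOn

/-! ### The equivalence -/

/-- The unit of a monoid and the inverse of `R` are determined by `μ` and `R`. -/
lemma QuasiCommutativeStructure.ext_of_mul_of_R {A : C} {Q Q' : QuasiCommutativeStructure A}
    (hmul : Q.mult = Q'.mult) (hR : Q.R.hom = Q'.R.hom) : Q = Q' := by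
  obtain ⟨hQ⟩ := Q
  obtain ⟨hQ'⟩ := Q'
  obtain rfl := MonObj.ext _ _ hmul
  obtain rfl := Iso.ext hR
  rfl

namespace CosimplicialMonoidOn

variable {N : ℕ∞} {h : 3 ≤ N} {A : C} {X Y : CosimplicialMonoidOn N h A}

lemma gen_app (f : X ⟶ Y) (n : FinOrdinal N) (i : Fin n.card) :
    X.gen n i ≫ (f.app.app n).hom = Y.gen n i := by
  have h1 : X.isoOne.inv ≫ (f.app.app (FinOrdinal.one h)).hom = Y.isoOne.inv := by
    rw [Iso.inv_comp_eq, ← f.app_one, Category.assoc, Iso.hom_inv_id, Category.comp_id]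
  rw [gen, gen, Category.assoc, ← Mon.comp_hom', f.app.naturality, Mon.comp_hom', ← h1,
    Category.assoc]

lemma toQuasiCommutativeStructure_eq_of_hom (f : X ⟶ Y) :
    X.toQuasiCommutativeStructure = Y.toQuasiCommutativeStructure := by
  apply QuasiCommutativeStructure.ext_of_mul_of_R
  · have h1 := X.mult_gen (FinOrdinal.one h) (FinOrdinal.only h)
    have h2 := Y.mult_gen (FinOrdinal.one h) (FinOrdinal.only h)
    have h3 := congrArg (fun k => k ≫ (f.app.app (FinOrdinal.one h)).hom) h1
    simp only [Category.assoc, IsMonHom.mul_hom, tensorHom_comp_tensorHom_assoc, gen_app] at h3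
    have h4 := h3.trans h2.symm
    rwa [gen_one, cancel_mono] at h4
  · apply Y.eq_of_comp_mul
    have hX := X.gen_comm (FinOrdinal.two h) (FinOrdinal.fst_le_snd h)
    have hY := Y.gen_comm (FinOrdinal.two h) (FinOrdinal.fst_le_snd h)
    have h3 := congrArg (fun k => k ≫ (f.app.app (FinOrdinal.two h)).hom) hX
    simp only [Category.assoc, IsMonHom.mul_hom, tensorHom_comp_tensorHom_assoc, gen_app] at h3
    exact h3.symm.trans hY

instance : Subsingleton (X ⟶ Y) where
  allEq f g := by
    apply Hom.ext
    ext n : 2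
    exact hom_ext_gen fun i => (gen_app f n i).trans (gen_app g n i).symm

/-- The morphism between two cosimplicial monoids with the same quasi-commutative structure, which
matches the generators. -/
noncomputable def homOfEq
    (hXY : X.toQuasiCommutativeStructure = Y.toQuasiCommutativeStructure) : X ⟶ Y :=
  have hY (n : FinOrdinal N) :
      X.toQuasiCommutativeStructure.IsOrdered (ofMon (Y.functor.obj n)) (Y.gen n) :=
    hXY ▸ (Y.toModel n).isOrdered
  { app :=
      { app := fun n => X.lift n (hY n)
        naturality := fun m n f => hom_ext_gen fun i => by
          rw [Mon.comp_hom', Mon.comp_hom', ← Category.assoc, ← Category.assoc, gen_map, gen_lift,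
            gen_lift, gen_map] }
    app_one := by
      have h1 := X.gen_lift (FinOrdinal.one h) (hY _) (FinOrdinal.only h)
      rw [gen_one, gen_one, Iso.inv_comp_eq] at h1
      rw [h1, Category.assoc, Iso.inv_hom_id, Category.comp_id] }

variable (N h A) in
/-- The functor which takes a cosimplicial monoid to its quasi-commutative structure. -/
noncomputable def toDiscrete :
    CosimplicialMonoidOn N h A ⥤ Discrete (QuasiCommutativeStructure A) where
  obj X := ⟨X.toQuasiCommutativeStructure⟩
  map f := Discrete.eqToHom (toQuasiCommutativeStructure_eq_of_hom f)

lemma toQuasiCommutativeStructure_toCosimplicialMonoidOn (Q : QuasiCommutativeStructure A) :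
    (Q.toCosimplicialMonoidOn N h).toQuasiCommutativeStructure = Q := by
  set X := Q.toCosimplicialMonoidOn N h
  -- The equality `A^1 = A` holds by definition, so `X.gen n i` is `𝟙 A` followed by a lift.
  have hgen (n : FinOrdinal N) (i : Fin n.card) : X.gen n i = (Q.model n.card).gen i :=
    (Category.id_comp _).trans ((Category.id_comp _).symm.trans (Q.selfModel.gen_lift
      ((Q.model n.card).isOrdered.comp_monotone
        (FinOrdinal.monotone_toFun (FinOrdinal.point h i))) (0 : Fin 1)))
  apply QuasiCommutativeStructure.ext_of_mul_of_R
  · change (𝟙 A ⊗ₘ 𝟙 A) ≫ Q.mult ≫ 𝟙 A = Q.mult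
    rw [Category.comp_id, id_tensorHom_id, Category.id_comp]
  · apply X.eq_of_comp_mul
    refine (X.gen_comm (FinOrdinal.two h) (FinOrdinal.fst_le_snd h)).symm.trans ?_
    rw [hgen, hgen]
    exact (Q.model 2).isOrdered.comm (0 : Fin 2) (1 : Fin 2) (by decide)

instance : (toDiscrete N h A).IsEquivalence where
  faithful := ⟨fun _ => Subsingleton.elim _ _⟩
  full := ⟨fun f => ⟨homOfEq (Discrete.eq_of_hom f), Subsingleton.elim _ _⟩⟩
  essSurj := ⟨fun Q => ⟨Q.as.toCosimplicialMonoidOn N h,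
    ⟨Discrete.eqToIso (toQuasiCommutativeStructure_toCosimplicialMonoidOn _)⟩⟩⟩

/-- Truncation does not change the quasi-commutative structure. -/
noncomputable def truncateCompToDiscrete (A : C) :
    truncate A ⋙ toDiscrete 3 le_rfl A ≅ toDiscrete ⊤ le_top A :=
  NatIso.ofComponents (fun _ => Discrete.eqToIso rfl) (fun _ => Subsingleton.elim _ _)

end CosimplicialMonoidOn

end QuasiComm

open QuasiComm in
theorem mainTheorem1 {C : Type u} [Category.{v} C] [MonoidalCategory C] (A : C) :
    (CosimplicialMonoidOn.truncate A).IsEquivalence ∧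
    ∃ Φ : CosimplicialMonoidOn 3 le_rfl A ⥤ Discrete (QuasiCommutativeStructure A),
      Φ.IsEquivalence ∧
      (CosimplicialMonoidOn.truncate A ⋙ Φ).IsEquivalence ∧
      ∀ X : CosimplicialMonoidOn 3 le_rfl A,
        (Φ.obj X).as.toMonObj = X.monObj ∧
        ∃ _ : IsIso (X.mulCofaces 0 1),
          (Φ.obj X).as.R.hom = X.mulCofaces 1 0 ≫ inv (X.mulCofaces 0 1) := by
  have h : (CosimplicialMonoidOn.truncate A ⋙
      CosimplicialMonoidOn.toDiscrete 3 le_rfl A).IsEquivalence :=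
    Functor.isEquivalence_of_iso (CosimplicialMonoidOn.truncateCompToDiscrete A).symm
  exact ⟨Functor.isEquivalence_of_comp_right _ (CosimplicialMonoidOn.toDiscrete 3 le_rfl A),
    CosimplicialMonoidOn.toDiscrete 3 le_rfl A, inferInstance, h,
    fun X => ⟨rfl, inferInstance, rfl⟩⟩
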